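/- **Setting.** A (general) logic program $P$ is a finite list of clauses $A\leftarrow L_1,\dots,L_n$ ($A$ an atom, each $L_i$ an atom or a negated atom) over a first-order language. A query $Q_0=p(s_1,\dots,s_n)$ is a single atom whose arguments $s_i$ are terms or *input modes* $\mathcal I$; it is *moded* if some argument is an input mode and *concrete* otherwise. $HU(P)$ is the set of ground terms built from the constants and function symbols of $P$ (an arbitrary constant $c$ is added if $P$ contains none). *Generalized SLDNF-trees.* Goals are evaluated by SLDNF-resolution, always selecting the left-most subgoal and trying clauses in program order. A selected positive subgoal $A$ gives a child for each clause whose (renamed) head unifies with $A$, via a most general unifier (mgu); for variables $X$ of $A$ and $Y$ of the clause, $X$ is substituted for $Y$. The new subgoals have as ancestors $A$ and all ancestors of $A$; the remaining subgoals keep theirs. A selected ground subgoal $\neg A$ gives a *negation arc* to the root $\leftarrow A$ of a subsidiary tree, where $A$ inherits the ancestors of $\neg A$, and, if that tree is finitely failed, a child in which $\neg A$ is removed. A subsidiary tree is not expanded beyond its first success leaf. The path from the root to a node, negation arcs included, is a *derivation*. A derivation may also be infinite. *Moded trees and termination.* The *moded generalized SLDNF-tree* $MT_{Q_0}$ is the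 generalized SLDNF-tree for $\leftarrow Q_0$ with each input mode replaced by a distinct *input variable* not occurring in $Q_0$; an input variable is never substituted by a non-input variable, and if it is substituted by a term, all variables of that term become input variables. $P$ *terminates* for $Q_0$ if no generalized SLDNF-tree for a goal obtained from $\leftarrow Q_0$ by replacing the input modes by terms of $HU(P)$ contains an infinite derivation (for concrete $Q_0$: the tree for $\leftarrow Q_0$ contains none). *Loop goals.* The symbol string of an atom is its sequence of predicate symbol, function symbols, constants and variables, read from left to right, with every variable replaced by one symbol $\mathcal X$. For nodes $N_i:G_i$ and $N_j:G_j$ of a derivation with positive selected subgoals $A_i$, $A_j$, the goal $G_j$ is a *loop goal* of $G_i$ if $A_i$ is an ancestor of $A_j$, both have the same predicate symbol, and the symbol string of $A_i$ is a (not necessarily contiguous) subsequence of that of $A_j$. **Algorithm** TPoLP$(P,Q_0,r)$, with $r\ge 2$. Set $L=0$ and construct $MT_{Q_0}$ depth-first. Whenever a derivation prefix $$D_x:\quad N_0:G_0\Rightarrow\cdots N_{g_1}:G_{g_1}\Rightarrow_{C}\cdots N_{g_2}:G_{g_2}\Rightarrow_{C}\cdots N_{g_r}:G_{g_r}\Rightarrow_{C}$$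 is produced in which the same clause $C$ is applied at all $N_{g_j}$ and $G_{g_{j+1}}$ is a loop goal of $G_{g_j}$ for $1\le j<r$: if $D_x$ lacks the term-size decrease property, stop and return *predicted-non-terminating*; otherwise set $L=1$ and continue from $N_{g_r}$ with $C$ skipped. When the construction is complete, return *terminating* if $L=0$ and *predicted-terminating* if $L=1$. Here $D_x$ has the *term-size decrease property* if for each $0<i<r$ some substitution $X/f(\dots Y\dots)$ is made between $N_{g_i}$ and $N_{g_{i+1}}$, with $X$ an input variable and $Y$ a variable occurring in the selected subgoal of $G_{g_{i+1}}$. **Theorem.** Let $P$ be a logic program, $Q_0$ a concrete or moded query and $r\ge2$, and suppose that $Q_0$ is non-floundering, i.e. no negative subgoal containing a variable is selected at any node of $MT_{Q_0}$. If TPoLP$(P,Q_0,r)$ returns *terminating*, then: 1. $P$ terminates for $Q_0$; 2. $MT_{Q_0}$ is finite; 3. $MT_{Q_0}$ has no infinite derivation such that (i) it contains nodes $N_{g_1},N_{g_2},\dots$ with $g_1<g_2<\cdots$ and $G_{g_{j+1}}$ a loop goal of $G_{g_j}$ for all $j\ge1$, and (ii) for no input variable $I$ does it contain an infinite chain of substitutions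 $I/f_1(\dots,Y_1,\dots),\dots,Y_1/f_2(\dots,Y_2,\dots),\dots$. -/

import Mathlib

namespace LogicProg

universe u v

/-! Terms, atoms, literals, clauses and programs over a first-order language `L`.
Constants are the function symbols of arity `0`; predicate symbols are the relation symbols. -/

/-- An atom `p(t₁, …, tₙ)` with variables in `V`. -/
structure Atom (L : FirstOrder.Language.{u, v}) (V : Type) where
  arity : ℕ
  pred : L.Relations arity
  args : Fin arity → L.Term V

/-- A literal: an atom or a negated atom. -/
inductive Literal (L : FirstOrder.Language.{u, v}) (V : Type) where
  | pos (A : Atom L V)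
  | neg (A : Atom L V)

/-- A clause `head ← body`; its variables are natural numbers. -/
structure Clause (L : FirstOrder.Language.{u, v}) where
  head : Atom L ℕ
  body : List (Literal L ℕ)

/-- A general logic program: finitely many clauses, in the order in which they are tried. -/
abbrev Program (L : FirstOrder.Language.{u, v}) := List (Clause L)

/-- A query consisting of one atom; an argument is `none` if it is an input mode, and `some T` if
it is the term `T`.  The query is moded if some argument is `none`, and concrete otherwise. -/
structure Query (L : FirstOrder.Language.{u, v}) where
  arity : ℕ
  pred : L.Relations arity
  args : Fin arity → Option (L.Term ℕ)

/-- Variables occurring in derivations: the input variable that stands for the input mode at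
argument `i` of the query, the variables of the query, and the variables of the copy of a clause
that is used at the node of depth `d` (clauses are thus standardized apart along a derivation). -/
inductive PVar where
  | input (i : ℕ)
  | query (x : ℕ)
  | clause (d x : ℕ)
  deriving DecidableEq

variable {L : FirstOrder.Language.{u, v}}

/-- The atom of a literal. -/
def Literal.atom {V : Type} : Literal L V → Atom L V
  | .pos A => A
  | .neg A => A

/-- Apply a substitution to an atom. -/
def Atom.subst {V W : Type} (A : Atom L V) (θ : V → L.Term W) : Atom L W :=
  ⟨A.arity, A.pred, fun i => (A.args i).subst θ⟩

/-- Apply a substitution to a literal. -/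
def Literal.subst {V W : Type} (θ : V → L.Term W) : Literal L V → Literal L W
  | .pos A => .pos (A.subst θ)
  | .neg A => .neg (A.subst θ)

/-- The variables of an atom. -/
def Atom.vars (A : Atom L PVar) : Set PVar := {x | ∃ i, x ∈ (A.args i).varFinset}

/-- An atom is ground if it contains no variable. -/
def Atom.Ground (A : Atom L PVar) : Prop := A.vars = ∅

/-- The renaming of clause variables used at depth `d`. -/
def freshen (L : FirstOrder.Language.{u, v}) (d : ℕ) : ℕ → L.Term PVar := fun x => .var (.clause d x)

/-! Symbol strings and the relation "loops into". -/

/-- Elements of symbol strings: predicate symbols, function symbols (and constants), and the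
symbol `X` that replaces every variable. -/
inductive Sym (L : FirstOrder.Language.{u, v}) where
  | pred {n : ℕ} (p : L.Relations n)
  | fn {n : ℕ} (f : L.Functions n)
  | X

/-- The symbol string of a term. -/
def termString {V : Type} : L.Term V → List (Sym L)
  | .var _ => [Sym.X]
  | .func f ts => Sym.fn f :: (List.ofFn fun i => termString (ts i)).flatten

/-- The symbol string of an atom. -/
def Atom.string {V : Type} (A : Atom L V) : List (Sym L) :=
  Sym.pred A.pred :: (List.ofFn fun i => termString (A.args i)).flatten

/-- `A` loops into `B`: they have the same predicate symbol and the symbol string of `A` is a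
projection of the one of `B`, that is, it is obtained by removing zero or more elements. -/
def Atom.LoopsInto (A B : Atom L PVar) : Prop :=
  (⟨A.arity, A.pred⟩ : Σ n, L.Relations n) = ⟨B.arity, B.pred⟩ ∧ A.string.Sublist B.string

/-! The Herbrand universe. -/

/-- The function symbol (or constant) `f` occurs in the program `P`. -/
def OccursIn {n : ℕ} (f : L.Functions n) (P : Program L) : Prop :=
  ∃ C ∈ P, Sym.fn f ∈ C.head.string ∨ ∃ l ∈ C.body, Sym.fn f ∈ l.atom.string

/-- The Herbrand universe of `P`: the ground terms built from the constants and function symbols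
of `P`; if no constant occurs in `P`, the constant `c` is added. -/
def HU (P : Program L) (c : L.Constants) : Set (L.Term PVar) :=
  {t | t.varFinset = ∅ ∧ ∀ (n : ℕ) (f : L.Functions n), Sym.fn f ∈ termString t →
    OccursIn f P ∨
      ((∀ a : L.Constants, ¬ OccursIn a P) ∧ (⟨n, f⟩ : Σ n, L.Functions n) = ⟨0, c⟩)}

/-! Most general unifiers. -/

/-- `θ` is an idempotent, relevant most general unifier of the selected atom `A` and the (renamed)
clause head `B`.  Its variable-for-variable bindings obey two conventions: a variable of `A` is
never replaced by a variable of the clause, and an input variable (a member of `inputs`) is never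
replaced by a variable that is not an input variable. -/
structure IsMgu (inputs : Set PVar) (A B : Atom L PVar) (θ : PVar → L.Term PVar) : Prop where
  unifies : A.subst θ = B.subst θ
  mostGeneral : ∀ τ : PVar → L.Term PVar, A.subst τ = B.subst τ → ∀ x, (θ x).subst τ = τ x
  fixes : ∀ x, x ∉ A.vars ∪ B.vars → θ x = .var x
  relevant : ∀ x ∈ A.vars ∪ B.vars, ∀ y ∈ (θ x).varFinset, y ∈ A.vars ∪ B.vars
  goal_var : ∀ x ∈ A.vars, ∀ y, θ x = .var y → y ∈ A.vars
  input_var : ∀ x ∈ inputs, ∀ y, θ x = .var y → y ∈ inputs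

open Classical in
/-- The mgu used in derivation steps (mgus are unique up to renaming; one is fixed here). -/
noncomputable def mgu (inputs : Set PVar) (A B : Atom L PVar) : Option (PVar → L.Term PVar) :=
  if h : ∃ θ, IsMgu inputs A B θ then some h.choose else none

/-! Nodes and edges of generalized SLDNF-trees. -/

/-- A node of a generalized SLDNF-tree.  `depth` is its position on the generalized derivation that
leads to it.  Each subgoal is paired with the set of (the depths of the nodes of) its ancestor
subgoals.  `inputs` are the input variables.  `subsidiary` tells whether the node lies in a
subsidiary SLDNF-tree.  The selected subgoal is the left-most one. -/
structure Node (L : FirstOrder.Language.{u, v}) where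
  depth : ℕ
  goal : List (Literal L PVar × Set ℕ)
  inputs : Set PVar
  subsidiary : Bool

/-- `A` is the selected subgoal at `N`, and it is positive. -/
def Node.SelectsPos (N : Node L) (A : Atom L PVar) : Prop :=
  ∃ anc rest, N.goal = (.pos A, anc) :: rest

/-- `¬ A` is the selected subgoal at `N`. -/
def Node.SelectsNeg (N : Node L) (A : Atom L PVar) : Prop :=
  ∃ anc rest, N.goal = (.neg A, anc) :: rest

/-- The mgu with which the clause `C` is applied at `N`, if it is applicable. -/
noncomputable def Node.mguWith (N : Node L) (C : Clause L) : Option (PVar → L.Term PVar) :=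
  match N.goal with
  | (.pos A, _) :: _ => mgu N.inputs A (C.head.subst (freshen L N.depth))
  | _ => none

/-- The child of `N` obtained by applying the clause `C` with the mgu `θ`.  The new subgoals get
the ancestors of the selected subgoal, and the selected subgoal itself, as ancestors; the other
subgoals keep theirs.  The variables in terms substituted for input variables become input
variables. -/
def Node.resolvent (N : Node L) (C : Clause L) (θ : PVar → L.Term PVar) : Node L where
  depth := N.depth + 1
  goal :=
    match N.goal with
    | [] => []
    | (_, anc) :: rest =>
      (C.body.map fun l => ((l.subst (freshen L N.depth)).subst θ, insert N.depth anc)) ++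
        rest.map fun s => (s.1.subst θ, s.2)
  inputs := N.inputs ∪ {y | ∃ x ∈ N.inputs, y ∈ (θ x).varFinset}
  subsidiary := N.subsidiary

/-- The child of `N` via the clause `C`, if `C` is applicable at `N`. -/
noncomputable def Node.child (N : Node L) (C : Clause L) : Option (Node L) :=
  (N.mguWith C).map (N.resolvent C)

/-- For a node whose selected subgoal is a ground literal `¬ A`: the root of the subsidiary tree
for `← A`.  Here `A` inherits the ancestors of `¬ A`.  As `A` is ground, no input variable occurs
in the subsidiary tree. -/
def Node.negRoot (N : Node L) : Node L where
  depth := N.depth + 1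
  goal := (N.goal.take 1).map fun s => (.pos s.1.atom, s.2)
  inputs := ∅
  subsidiary := true

/-- The child of `N` in which the selected (negative) subgoal has been removed. -/
def Node.negNext (N : Node L) : Node L where
  depth := N.depth + 1
  goal := N.goal.tail
  inputs := N.inputs
  subsidiary := N.subsidiary

mutual

/-- The SLDNF-tree rooted at the node has a success leaf. -/
inductive Succeeds (P : Program L) : Node L → Prop
  | leaf (N : Node L) (h : N.goal = []) : Succeeds P N
  | clause (N M : Node L) (C : Clause L) (hC : C ∈ P) (hM : N.child C = some M)
      (h : Succeeds P M) : Succeeds P N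
  | naf (N : Node L) (A : Atom L PVar) (hA : N.SelectsNeg A) (hg : A.Ground)
      (hf : FinitelyFails P N.negRoot) (h : Succeeds P N.negNext) : Succeeds P N

/-- The SLDNF-tree rooted at the node is finitely failed. -/
inductive FinitelyFails (P : Program L) : Node L → Prop
  | clauses (N : Node L) (A : Atom L PVar) (hA : N.SelectsPos A)
      (h : ∀ C ∈ P, ∀ M, N.child C = some M → FinitelyFails P M) : FinitelyFails P N
  | negSucceeds (N : Node L) (A : Atom L PVar) (hA : N.SelectsNeg A) (hg : A.Ground)
      (h : Succeeds P N.negRoot) : FinitelyFails P N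
  | naf (N : Node L) (A : Atom L PVar) (hA : N.SelectsNeg A) (hg : A.Ground)
      (hf : FinitelyFails P N.negRoot) (h : FinitelyFails P N.negNext) : FinitelyFails P N

end

/-- Labels of the edges of a generalized SLDNF-tree: the application of a clause, a negation arc,
or the removal of a negative subgoal by negation as failure. -/
inductive Label (L : FirstOrder.Language.{u, v}) where
  | clause (C : Clause L)
  | negArc
  | naf

/-- The edges of generalized SLDNF-trees.  A subsidiary tree stops at its first success leaf: no
edge is drawn to a child one of whose left siblings leads to a success leaf. -/
inductive Edge (P : Program L) : Node L → Label L → Node L → Prop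
  | clause (N M : Node L) (C : Clause L) (before after : List (Clause L))
      (hP : P = before ++ C :: after) (hM : N.child C = some M)
      (hprune : N.subsidiary = true →
        ∀ C' ∈ before, ∀ M', N.child C' = some M' → ¬ Succeeds P M') :
      Edge P N (.clause C) M
  | negArc (N : Node L) (A : Atom L PVar) (hA : N.SelectsNeg A) (hg : A.Ground) :
      Edge P N .negArc N.negRoot
  | naf (N : Node L) (A : Atom L PVar) (hA : N.SelectsNeg A) (hg : A.Ground)
      (hf : FinitelyFails P N.negRoot) : Edge P N .naf N.negNext

/-- `Path P R D N`: the list `D` of nodes and edge labels is a finite generalized derivation from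
`R` to `N` (the end node `N` is not listed in `D`). -/
inductive Path (P : Program L) (R : Node L) : List (Node L × Label L) → Node L → Prop
  | nil : Path P R [] R
  | snoc (D : List (Node L × Label L)) (N M : Node L) (e : Label L)
      (hD : Path P R D N) (he : Edge P N e M) : Path P R (D ++ [(N, e)]) M

/-- The generalized SLDNF-tree rooted at `R`: its nodes, each together with the path that leads to
it from the root. -/
def GTree (P : Program L) (R : Node L) : Set (List (Node L × Label L) × Node L) :=
  {x | Path P R x.1 x.2}

/-- An infinite (generalized SLDNF-)derivation in the generalized SLDNF-tree rooted at `R`. -/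
structure InfDerivation (P : Program L) (R : Node L) where
  node : ℕ → Node L
  label : ℕ → Label L
  root : node 0 = R
  edge : ∀ i, Edge P (node i) (label i) (node (i + 1))

/-- No non-ground negative subgoal is selected in the generalized SLDNF-tree rooted at `R`. -/
def NonFloundering (P : Program L) (R : Node L) : Prop :=
  ∀ x ∈ GTree P R, ∀ A, x.2.SelectsNeg A → A.Ground

/-! Moded-query forests and moded generalized SLDNF-trees. -/

/-- The root `← A` of a generalized SLDNF-tree, with the given set of input variables. -/
def rootNode (A : Atom L PVar) (inputs : Set PVar) : Node L where
  depth := 0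
  goal := [(.pos A, ∅)]
  inputs := inputs
  subsidiary := false

/-- The atom obtained from a query by replacing its input modes by the terms `σ i`. -/
def Query.fill (Q : Query L) (σ : Fin Q.arity → L.Term PVar) : Atom L PVar where
  arity := Q.arity
  pred := Q.pred
  args := fun i =>
    match Q.args i with
    | none => σ i
    | some t => t.subst fun x => .var (.query x)

/-- The root of the moded generalized SLDNF-tree of a query: every input mode is replaced by a
distinct input variable. -/
def Query.modedRoot (Q : Query L) : Node L :=
  rootNode (Q.fill fun i => .var (.input i))
    {x | ∃ i : Fin Q.arity, Q.args i = none ∧ x = .input i}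

/-- The moded generalized SLDNF-tree of `P` for `Q`. -/
def ModedTree (P : Program L) (Q : Query L) : Set (List (Node L × Label L) × Node L) :=
  GTree P Q.modedRoot

/-- The roots of the trees in the moded-query forest of `P` for `Q`: every input mode is replaced
by a term of the Herbrand universe. -/
def forestRoots (P : Program L) (c : L.Constants) (Q : Query L) : Set (Node L) :=
  {R | ∃ σ : Fin Q.arity → L.Term PVar,
    (∀ i, Q.args i = none → σ i ∈ HU P c) ∧ R = rootNode (Q.fill σ) ∅}

/-- `P` terminates for `Q`: the moded-query forest has no infinite derivation. (For a concrete
query the forest is the single generalized SLDNF-tree of the query.) -/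
def Terminates (P : Program L) (c : L.Constants) (Q : Query L) : Prop :=
  ∀ R ∈ forestRoots P c Q, IsEmpty (InfDerivation P R)

/-! Loop goals and chains of substitutions. -/

/-- For nodes `N` and `M` of one derivation: the goal at `M` is a loop goal of the goal at `N`,
i.e. the selected subgoals are positive, the one at `N` is an ancestor of the one at `M`, and it
loops into the one at `M`. -/
def LoopGoal (N M : Node L) : Prop :=
  ∃ A, N.SelectsPos A ∧ ∃ B anc rest, M.goal = (.pos B, anc) :: rest ∧
    N.depth ∈ anc ∧ A.LoopsInto B

/-- The step from `N` with label `e` uses a substitution `x/f(… y …)` with `x` an input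
variable. -/
def InputBinding (N : Node L) (e : Label L) (x y : PVar) : Prop :=
  ∃ C θ, e = .clause C ∧ N.mguWith C = some θ ∧ x ∈ N.inputs ∧
    (∀ z, θ x ≠ .var z) ∧ y ∈ (θ x).varFinset

/-- Condition (i) on an infinite derivation: it contains nodes `g 1 < g 2 < …` such that the goal
at `g (j + 1)` is always a loop goal of the goal at `g j`. -/
def InfDerivation.LoopSequence {P : Program L} {R : Node L} (D : InfDerivation P R) : Prop :=
  ∃ g : ℕ → ℕ, StrictMono g ∧ ∀ j, 1 ≤ j → LoopGoal (D.node (g j)) (D.node (g (j + 1)))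

/-- The infinite derivation contains an infinite chain of substitutions
`I/f₁(…,Y₁,…), …, Y₁/f₂(…,Y₂,…), …` for the input variable `I`. -/
def InfDerivation.InfChain {P : Program L} {R : Node L} (D : InfDerivation P R) (I : PVar) :
    Prop :=
  ∃ (m : ℕ → ℕ) (Y : ℕ → PVar), StrictMono m ∧ Y 0 = I ∧
    ∀ i, InputBinding (D.node (m i)) (D.label (m i)) (Y i) (Y (i + 1))

/-! The loop check and the prediction algorithm. -/

/-- The finite derivation `D`, whose last step applies the clause `C`, is of the form
`N₀ ⇒ … N_{g 1} ⇒_C … N_{g 2} ⇒_C … N_{g r} ⇒_C`, where the last step is the one at `N_{g r}`, and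
the goal at `g (j + 1)` is a loop goal of the goal at `g j` for `1 ≤ j < r`. -/
def LPPrefix (r : ℕ) (D : List (Node L × Label L)) (C : Clause L) (g : ℕ → ℕ) : Prop :=
  StrictMonoOn g (Set.Icc 1 r) ∧ g r + 1 = D.length ∧
  (∀ j, 1 ≤ j → j ≤ r → ∃ N, D[g j]? = some (N, .clause C)) ∧
  ∀ j, 1 ≤ j → j < r → ∃ N e M e', D[g j]? = some (N, e) ∧ D[g (j + 1)]? = some (M, e') ∧
    LoopGoal N M

/-- The term-size decrease property: for `0 < i < r` there is a substitution `x/f(… y …)` between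
`N_{g i}` and `N_{g (i + 1)}`, with `x` an input variable and `y` occurring in the selected subgoal
at `N_{g (i + 1)}`. -/
def TermSizeDecrease (r : ℕ) (D : List (Node L × Label L)) (g : ℕ → ℕ) : Prop :=
  ∀ i, 0 < i → i < r → ∃ m N e x y, g i ≤ m ∧ m < g (i + 1) ∧ D[m]? = some (N, e) ∧
    InputBinding N e x y ∧
    ∃ M e' A, D[g (i + 1)]? = some (M, e') ∧ M.SelectsPos A ∧ y ∈ A.vars

/-- Outcome of a part of the construction: either the procedure has jumped to its last line, or
the part has been constructed.  In the second case `L` is the current value of the flag, and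
`success` tells, for a part of a subsidiary tree, whether a success leaf has been found. -/
inductive Outcome where
  | abort
  | done (success L : Bool)

mutual

/-- `Explore P r D N b o`: the depth-first, left-most construction of the part of the tree below
the node `N`, which has been reached by the derivation `D`, and with `b` the value of the
flag `L`, halts with outcome `o`. -/
inductive Explore (P : Program L) (r : ℕ) :
    List (Node L × Label L) → Node L → Bool → Outcome → Prop
  | success (D : List (Node L × Label L)) (N : Node L) (b : Bool) (h : N.goal = []) :
      Explore P r D N b (.done true b)
  | flounder (D : List (Node L × Label L)) (N : Node L) (b : Bool) (A : Atom L PVar)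
      (hA : N.SelectsNeg A) (hg : ¬ A.Ground) :
      Explore P r D N b (.done false b)
  | positive (D : List (Node L × Label L)) (N : Node L) (b : Bool) (o : Outcome)
      (A : Atom L PVar) (hA : N.SelectsPos A)
      (h : ExploreClauses P r D N P b o) : Explore P r D N b o
  | negAbort (D : List (Node L × Label L)) (N : Node L) (b : Bool) (A : Atom L PVar)
      (hA : N.SelectsNeg A) (hg : A.Ground)
      (h : Explore P r (D ++ [(N, .negArc)]) N.negRoot b .abort) :
      Explore P r D N b .abort
  | negSucceeds (D : List (Node L × Label L)) (N : Node L) (b b' : Bool) (A : Atom L PVar)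
      (hA : N.SelectsNeg A) (hg : A.Ground)
      (h : Explore P r (D ++ [(N, .negArc)]) N.negRoot b (.done true b')) :
      Explore P r D N b (.done false b')
  | negFails (D : List (Node L × Label L)) (N : Node L) (b b' : Bool) (o : Outcome)
      (A : Atom L PVar) (hA : N.SelectsNeg A) (hg : A.Ground)
      (hf : Explore P r (D ++ [(N, .negArc)]) N.negRoot b (.done false b'))
      (h : Explore P r (D ++ [(N, .naf)]) N.negNext b' o) :
      Explore P r D N b o

/-- As `Explore`, for the children of `N` via the remaining clauses in the given list. -/
inductive ExploreClauses (P : Program L) (r : ℕ) :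
    List (Node L × Label L) → Node L → List (Clause L) → Bool → Outcome → Prop
  | nil (D : List (Node L × Label L)) (N : Node L) (b : Bool) :
      ExploreClauses P r D N [] b (.done false b)
  | notApplicable (D : List (Node L × Label L)) (N : Node L) (C : Clause L)
      (Cs : List (Clause L)) (b : Bool) (o : Outcome) (hC : N.child C = none)
      (h : ExploreClauses P r D N Cs b o) : ExploreClauses P r D N (C :: Cs) b o
  | loopAbort (D : List (Node L × Label L)) (N M : Node L) (C : Clause L)
      (Cs : List (Clause L)) (b : Bool) (hC : N.child C = some M)
      (h : ∃ g, LPPrefix r (D ++ [(N, .clause C)]) C g ∧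
        ¬ TermSizeDecrease r (D ++ [(N, .clause C)]) g) :
      ExploreClauses P r D N (C :: Cs) b .abort
  | loopSkip (D : List (Node L × Label L)) (N M : Node L) (C : Clause L)
      (Cs : List (Clause L)) (b : Bool) (o : Outcome) (hC : N.child C = some M)
      (hl : ∃ g, LPPrefix r (D ++ [(N, .clause C)]) C g)
      (hd : ∀ g, LPPrefix r (D ++ [(N, .clause C)]) C g →
        TermSizeDecrease r (D ++ [(N, .clause C)]) g)
      (h : ExploreClauses P r D N Cs true o) : ExploreClauses P r D N (C :: Cs) b o
  | childAbort (D : List (Node L × Label L)) (N M : Node L) (C : Clause L)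
      (Cs : List (Clause L)) (b : Bool) (hC : N.child C = some M)
      (hl : ¬ ∃ g, LPPrefix r (D ++ [(N, .clause C)]) C g)
      (h : Explore P r (D ++ [(N, .clause C)]) M b .abort) :
      ExploreClauses P r D N (C :: Cs) b .abort
  | firstSuccess (D : List (Node L × Label L)) (N M : Node L) (C : Clause L)
      (Cs : List (Clause L)) (b b' : Bool) (hC : N.child C = some M)
      (hl : ¬ ∃ g, LPPrefix r (D ++ [(N, .clause C)]) C g)
      (hs : N.subsidiary = true)
      (h : Explore P r (D ++ [(N, .clause C)]) M b (.done true b')) :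
      ExploreClauses P r D N (C :: Cs) b (.done true b')
  | continue (D : List (Node L × Label L)) (N M : Node L) (C : Clause L)
      (Cs : List (Clause L)) (b s b' : Bool) (o : Outcome) (hC : N.child C = some M)
      (hl : ¬ ∃ g, LPPrefix r (D ++ [(N, .clause C)]) C g)
      (hs : N.subsidiary = false ∨ s = false)
      (h : Explore P r (D ++ [(N, .clause C)]) M b (.done s b'))
      (h' : ExploreClauses P r D N Cs b' o) : ExploreClauses P r D N (C :: Cs) b o

end

/-- The answers of the prediction algorithm. -/
inductive Answer where
  | terminating
  | predictedTerminating
  | predictedNonTerminating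

/-- The procedure `TPoLP(P, Q, r)` halts and returns the given answer. -/
def TPoLPReturns (P : Program L) (Q : Query L) (r : ℕ) : Answer → Prop
  | .terminating => ∃ s, Explore P r [] Q.modedRoot false (.done s false)
  | .predictedTerminating => ∃ s, Explore P r [] Q.modedRoot false (.done s true)
  | .predictedNonTerminating => Explore P r [] Q.modedRoot false .abort

end LogicProg

-- The answer *terminating* means that the flag was never set, so no clause was skipped by the loop
-- check: the finite run has visited the whole moded tree. `Explore.sound` makes this precise by
-- induction on the run. Children below an unexplored clause are exactly those that `Edge` prunes in
-- subsidiary trees, provided that the reported successes and failures are correct; hence these are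
-- proved simultaneously with finiteness, and `Succeeds.not_finitelyFails` reconciles the two
-- notions. So the moded tree is finite. A tree with an infinite derivation has infinitely many
-- nodes (`InfDerivation.gTree_infinite`), which excludes in particular the derivations of the third
-- claim.
--
-- Termination for the instances of the query follows by lifting: an infinite derivation in a tree
-- of the forest yields one in the moded tree (`InfDerivation.nonempty_of_lifts`). One edge is
-- lifted at a time by `Node.Lifts.exists_edge`. Outside subsidiary trees the moded node is more
-- general than the concrete one, and a clause applicable to the latter applies to the former. At a
-- negation arc the selected atom is ground by non-floundering, so both sides enter literally the
-- same subsidiary tree. As `mgu` is defined by choice, lifting needs the existence of most general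
-- unifiers obeying the variable conventions; `exists_isEqMgu` gets them from unification with
-- ranked variables.

namespace LogicProg

universe u v

variable {L : FirstOrder.Language.{u, v}}

-- Substitutions and ranked unification

section Terms

open FirstOrder.Language (Term)

variable {V W X : Type}

theorem subst_subst (t : L.Term V) (σ : V → L.Term W) (τ : W → L.Term X) :
    (t.subst σ).subst τ = t.subst fun x => (σ x).subst τ := by
  induction t with
  | var => rfl
  | func f ts ih => simp [Term.subst, ih]

theorem subst_var (t : L.Term V) : t.subst (fun x => .var x) = t := by
  induction t with
  | var => rfl
  | func f ts ih => simp [Term.subst, ih]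

theorem mem_varFinset_subst [DecidableEq V] [DecidableEq W] (t : L.Term V) (σ : V → L.Term W)
    (y : W) : y ∈ (t.subst σ).varFinset ↔ ∃ x ∈ t.varFinset, y ∈ (σ x).varFinset := by
  induction t with
  | var => simp [Term.subst]
  | func f ts ih =>
    simp only [Term.subst, Term.varFinset, Finset.mem_biUnion, Finset.mem_univ, true_and, ih]
    constructor
    · rintro ⟨i, x, hx, hy⟩
      exact ⟨x, ⟨i, hx⟩, hy⟩
    · rintro ⟨x, ⟨i, hx⟩, hy⟩
      exact ⟨i, x, hx, hy⟩

theorem subst_congr [DecidableEq V] (t : L.Term V) (σ τ : V → L.Term W)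
    (h : ∀ x ∈ t.varFinset, σ x = τ x) : t.subst σ = t.subst τ := by
  induction t with
  | var x => exact h x (by simp)
  | func f ts ih =>
    simp only [Term.subst, Term.func.injEq, heq_eq_eq, true_and]
    refine funext fun i => ih i fun x hx => h x ?_
    simpa using ⟨i, hx⟩

/-- The number of symbols of a term. -/
def termSize : L.Term V → ℕ
  | .var _ => 1
  | .func _ ts => 1 + ∑ i, termSize (ts i)

theorem termSize_le_of_mem [DecidableEq V] (t : L.Term V) (τ : V → L.Term W) (x : V)
    (hx : x ∈ t.varFinset) : termSize (τ x) ≤ termSize (t.subst τ) := by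
  induction t with
  | var y => simp at hx; simp [hx, Term.subst]
  | func f ts ih =>
    simp only [Term.varFinset, Finset.mem_biUnion, Finset.mem_univ, true_and] at hx
    obtain ⟨i, hi⟩ := hx
    have h := Finset.single_le_sum (f := fun i => termSize ((ts i).subst τ))
      (fun _ _ => Nat.zero_le _) (Finset.mem_univ i)
    have h' := ih i hi
    simp only [Term.subst, termSize]
    omega

/-- A variable that occurs properly in a term cannot be unified with it. -/
theorem not_mem_varFinset_of_unifier [DecidableEq V] {l : ℕ} (f : L.Functions l)
    (ts : Fin l → L.Term V) (τ : V → L.Term W) (x : V)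
    (h : τ x = (Term.func f ts).subst τ) : x ∉ (Term.func f ts).varFinset := by
  intro hx
  simp only [Term.varFinset, Finset.mem_biUnion, Finset.mem_univ, true_and] at hx
  obtain ⟨i, hi⟩ := hx
  -- The image of `x` would be no larger than an instantiated argument, hence strictly smaller than
  -- the whole instantiated term it equals.
  have h1 := Finset.single_le_sum (f := fun i => termSize ((ts i).subst τ))
    (fun _ _ => Nat.zero_le _) (Finset.mem_univ i)
  have h2 := termSize_le_of_mem (ts i) τ x hi
  have h3 := congrArg termSize h
  simp only [Term.subst, termSize] at h1 h3
  omega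

/-- `τ` solves the list of equations `E`. -/
def Unifies (E : List (L.Term V × L.Term V)) (τ : V → L.Term W) : Prop :=
  ∀ p ∈ E, p.1.subst τ = p.2.subst τ

/-- The variable `x` occurs in the list of equations `E`. -/
def OccursInEqs [DecidableEq V] (E : List (L.Term V × L.Term V)) (x : V) : Prop :=
  ∃ p ∈ E, x ∈ p.1.varFinset ∨ x ∈ p.2.varFinset

/-- `θ` is a relevant, idempotent most general solution of the list of equations `E`, which
replaces no variable by one of higher rank. -/
structure IsEqMgu [DecidableEq V] (rank : V → ℕ) (E : List (L.Term V × L.Term V))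
    (θ : V → L.Term V) : Prop where
  unifies : Unifies E θ
  mostGeneral : ∀ τ : V → L.Term V, Unifies E τ → ∀ x, (θ x).subst τ = τ x
  fixes : ∀ x, ¬ OccursInEqs E x → θ x = .var x
  relevant : ∀ x, OccursInEqs E x → ∀ y ∈ (θ x).varFinset, OccursInEqs E y
  rank_le : ∀ x y, θ x = .var y → rank y ≤ rank x

/-- The total size of a list of equations. -/
def eqsSize (E : List (L.Term V × L.Term V)) : ℕ :=
  (E.map fun p => termSize p.1 + termSize p.2).sum

/-- Two lists of equations with the same solutions and the same variables have the same most
general solutions. -/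
theorem IsEqMgu.of_equiv [DecidableEq V] {rank : V → ℕ} {E E' : List (L.Term V × L.Term V)}
    {θ : V → L.Term V} (h : IsEqMgu rank E θ)
    (hu : ∀ τ : V → L.Term V, Unifies E τ ↔ Unifies E' τ)
    (hv : ∀ x, OccursInEqs E x → OccursInEqs E' x)
    (hfix : ∀ x, OccursInEqs E' x → ¬ OccursInEqs E x → θ x = .var x) :
    IsEqMgu rank E' θ where
  unifies := (hu θ).1 h.unifies
  mostGeneral τ hτ := h.mostGeneral τ ((hu τ).2 hτ)
  fixes x hx := h.fixes x fun hx' => hx (hv x hx')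
  relevant x hx y hy := by
    -- A variable of `E'` missing from `E` (as when a trivial equation `x = x` is dropped) must be
    -- fixed by `θ`.
    by_cases hx' : OccursInEqs E x
    · exact hv y (h.relevant x hx' y hy)
    · rw [hfix x hx hx'] at hy
      simp at hy
      exact hy ▸ hx
  rank_le := h.rank_le

/-- Elimination of a variable. -/
theorem IsEqMgu.eliminate [DecidableEq V] {rank : V → ℕ} {E : List (L.Term V × L.Term V)}
    {θ : V → L.Term V} {x : V} {t : L.Term V} (hx : x ∉ t.varFinset)
    (hr : ∀ y, t = .var y → rank y ≤ rank x)
    (h : IsEqMgu rank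
      (E.map fun p => (p.1.subst (Function.update .var x t), p.2.subst (Function.update .var x t)))
      θ) :
    IsEqMgu rank ((.var x, t) :: E) fun z => (Function.update Term.var x t z).subst θ := by
  set ρ : V → L.Term V := Function.update Term.var x t with hρ
  have hρx : ρ x = t := by simp [ρ]
  have hρz : ∀ z, z ≠ x → ρ z = .var z := fun z hz => by simp [ρ, hz]
  have ht : t.subst ρ = t := by
    conv_rhs => rw [← subst_var t]
    exact subst_congr _ _ _ fun z hz => hρz z fun e => hx (e ▸ hz)
  have hocc : ∀ z, OccursInEqs (E.map fun p => (p.1.subst ρ, p.2.subst ρ)) z →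
      OccursInEqs ((.var x, t) :: E) z := by
    have aux : ∀ s : L.Term V, ∀ z ∈ (s.subst ρ).varFinset,
        z ∈ s.varFinset ∨ z ∈ t.varFinset := by
      intro s z hz
      obtain ⟨w, hw, hz⟩ := (mem_varFinset_subst _ _ _).1 hz
      by_cases hwx : w = x
      · subst hwx; rw [hρx] at hz; exact .inr hz
      · rw [hρz w hwx] at hz; simp at hz; exact .inl (hz ▸ hw)
    rintro z ⟨p, hp, hz⟩
    obtain ⟨q, hq, rfl⟩ := List.mem_map.1 hp
    rcases hz with hz | hz <;> rcases aux _ z hz with hz | hz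
    · exact ⟨q, by simp [hq], .inl hz⟩
    · exact ⟨_, List.mem_cons_self, .inr hz⟩
    · exact ⟨q, by simp [hq], .inr hz⟩
    · exact ⟨_, List.mem_cons_self, .inr hz⟩
  have hxocc : ¬ OccursInEqs (E.map fun p => (p.1.subst ρ, p.2.subst ρ)) x := by
    have aux : ∀ s : L.Term V, x ∉ (s.subst ρ).varFinset := by
      intro s hz
      obtain ⟨w, hw, hz⟩ := (mem_varFinset_subst _ _ _).1 hz
      by_cases hwx : w = x
      · subst hwx; rw [hρx] at hz; exact hx hz
      · rw [hρz w hwx] at hz; simp at hz; exact hwx hz.symm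
    rintro ⟨p, hp, hz⟩
    obtain ⟨q, hq, rfl⟩ := List.mem_map.1 hp
    exact hz.elim (aux _) (aux _)
  have hθocc : ∀ s : L.Term V, (∀ z ∈ s.varFinset, OccursInEqs ((.var x, t) :: E) z) →
      ∀ y ∈ (s.subst θ).varFinset, OccursInEqs ((.var x, t) :: E) y := by
    intro s hs y hy
    obtain ⟨w, hw, hy⟩ := (mem_varFinset_subst _ _ _).1 hy
    by_cases hw' : OccursInEqs (E.map fun p => (p.1.subst ρ, p.2.subst ρ)) w
    · exact hocc y (h.relevant w hw' y hy)
    · rw [h.fixes w hw'] at hy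
      simp at hy
      exact hy ▸ hs w hw
  refine ⟨?_, ?_, ?_, ?_, ?_⟩
  · intro p hp
    rcases List.mem_cons.1 hp with rfl | hp
    · change (ρ x).subst θ = t.subst fun z => (ρ z).subst θ
      rw [← subst_subst, ht, hρx]
    · rw [← subst_subst, ← subst_subst]
      exact h.unifies (p.1.subst ρ, p.2.subst ρ) (List.mem_map.2 ⟨p, hp, rfl⟩)
  · intro τ hτ z
    have hx' : τ x = t.subst τ := hτ (.var x, t) List.mem_cons_self
    -- A solution of `x = t` does not notice that `x` has been replaced by `t`, so it also solves
    -- the reduced system and factors through `θ`.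
    have hρτ : ∀ z, (ρ z).subst τ = τ z := by
      intro z
      by_cases hz : z = x
      · subst hz; rw [hρx, hx']
      · rw [hρz z hz]; rfl
    have hτ' : Unifies (E.map fun p => (p.1.subst ρ, p.2.subst ρ)) τ := by
      intro p hp
      obtain ⟨q, hq, rfl⟩ := List.mem_map.1 hp
      simp only [subst_subst, hρτ]
      exact hτ q (List.mem_cons_of_mem _ hq)
    rw [subst_subst]
    simp only [h.mostGeneral τ hτ', hρτ]
  · intro z hz
    have hzx : z ≠ x := by
      rintro rfl
      exact hz ⟨_, List.mem_cons_self, .inl (by simp)⟩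
    change (ρ z).subst θ = _
    rw [hρz z hzx]
    exact h.fixes z fun h' => hz (hocc z h')
  · intro z hz
    refine hθocc (ρ z) fun w hw => ?_
    by_cases hzx : z = x
    · subst hzx
      rw [hρx] at hw
      exact ⟨_, List.mem_cons_self, .inr hw⟩
    · rw [hρz z hzx] at hw
      simp at hw
      exact hw ▸ hz
  · intro z y hy
    by_cases hzx : z = x
    · subst hzx
      change (ρ z).subst θ = _ at hy
      rw [hρx] at hy
      -- The image of the eliminated variable is `t.subst θ`. It is a variable only if `t` is one,
      -- and then the two rank inequalities compose.
      cases t with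
      | var w => exact (h.rank_le w y hy).trans (hr w rfl)
      | func f ts => simp [Term.subst] at hy
    · change (ρ z).subst θ = _ at hy
      rw [hρz z hzx] at hy
      exact h.rank_le z y hy

/-- Lets elimination be carried out for variables on the left of an equation only. -/
theorem IsEqMgu.swap [DecidableEq V] {rank : V → ℕ} {E : List (L.Term V × L.Term V)}
    {θ : V → L.Term V} {s t : L.Term V} (h : IsEqMgu rank ((s, t) :: E) θ) :
    IsEqMgu rank ((t, s) :: E) θ := by
  have hv : ∀ s t : L.Term V, ∀ x, OccursInEqs ((s, t) :: E) x → OccursInEqs ((t, s) :: E) x := by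
    simp only [OccursInEqs, List.exists_mem_cons_iff]
    rintro s t x (hx | hx)
    · exact .inl hx.symm
    · exact .inr hx
  refine h.of_equiv (fun τ => ?_) (hv s t) fun x hx hx' => absurd (hv t s x hx) hx'
  simp only [Unifies, List.forall_mem_cons]
  rw [eq_comm]

/-- Unifiable lists of equations have most general solutions. -/
theorem exists_isEqMgu [DecidableEq V] (rank : V → ℕ) (S : Finset V)
    (E : List (L.Term V × L.Term V)) (hS : ∀ x, OccursInEqs E x → x ∈ S)
    (hE : ∃ τ : V → L.Term V, Unifies E τ) : ∃ θ, IsEqMgu rank E θ := by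
  -- Lexicographic induction: eliminating a variable shrinks `S`; the other reductions keep `S` and
  -- shrink the total size of the equations.
  induction hn : S.card using Nat.strong_induction_on generalizing S E with
  | _ n ihn =>
  induction hm : eqsSize E using Nat.strong_induction_on generalizing E with
  | _ m ihm =>
  obtain ⟨τ, hτ⟩ := hE
  have elim : ∀ (x : V) (t : L.Term V) (E' : List (L.Term V × L.Term V)), x ∈ S →
      x ∉ t.varFinset → (∀ y ∈ t.varFinset, y ∈ S) → (∀ y, OccursInEqs E' y → y ∈ S) →
      (∀ y, t = .var y → rank y ≤ rank x) → τ x = t.subst τ → Unifies E' τ →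
      ∃ θ, IsEqMgu rank ((.var x, t) :: E') θ := by
    intro x t E' hxS hxt htS hES hr hx hE'
    have hρτ : ∀ z, (Function.update (Term.var : V → L.Term V) x t z).subst τ = τ z := by
      intro z
      by_cases hz : z = x
      · subst hz; simp [hx]
      · simp [hz, Term.subst]
    have hocc : ∀ s : L.Term V, (∀ z ∈ s.varFinset, z ∈ S) →
        ∀ z ∈ (s.subst (Function.update Term.var x t)).varFinset, z ∈ S.erase x := by
      intro s hs z hz
      obtain ⟨w, hw, hz⟩ := (mem_varFinset_subst _ _ _).1 hz
      by_cases hwx : w = x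
      · subst hwx
        simp at hz
        exact Finset.mem_erase.2 ⟨fun e => hxt (e ▸ hz), htS z hz⟩
      · simp [hwx] at hz
        exact Finset.mem_erase.2 ⟨fun e => hwx (hz ▸ e), hz ▸ hs w hw⟩
    obtain ⟨θ, hθ⟩ := ihn (S.erase x).card (hn ▸ Finset.card_erase_lt_of_mem hxS) (S.erase x)
      (E'.map fun p =>
        (p.1.subst (Function.update .var x t), p.2.subst (Function.update .var x t)))
      (by
        rintro z ⟨p, hp, hz⟩
        obtain ⟨q, hq, rfl⟩ := List.mem_map.1 hp
        rcases hz with hz | hz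
        · exact hocc q.1 (fun w hw => hES w ⟨q, hq, .inl hw⟩) z hz
        · exact hocc q.2 (fun w hw => hES w ⟨q, hq, .inr hw⟩) z hz)
      ⟨τ, by
        intro p hp
        obtain ⟨q, hq, rfl⟩ := List.mem_map.1 hp
        simp only [subst_subst, hρτ]
        exact hE' q hq⟩ rfl
    exact ⟨_, hθ.eliminate hxt hr⟩
  match E, hS, hτ, hm with
  | [], _, _, _ =>
    exact ⟨fun x => .var x, fun p hp => by simp at hp, fun _ _ _ => rfl, fun _ _ => rfl,
      fun x ⟨p, hp, _⟩ => by simp at hp, fun x y h => by cases h; exact le_rfl⟩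
  | (.var x, .var y) :: E', hS, hτ, hm =>
    have hxS : x ∈ S := hS x ⟨_, List.mem_cons_self, .inl (by simp)⟩
    have hyS : y ∈ S := hS y ⟨_, List.mem_cons_self, .inr (by simp)⟩
    have hE' : ∀ z, OccursInEqs E' z → z ∈ S := fun z ⟨p, hp, hz⟩ =>
      hS z ⟨p, List.mem_cons_of_mem _ hp, hz⟩
    have hu : Unifies E' τ := fun p hp => hτ p (List.mem_cons_of_mem _ hp)
    have hxy : τ x = τ y := hτ _ List.mem_cons_self
    by_cases e : x = y
    · subst e
      obtain ⟨θ, hθ⟩ := ihm (eqsSize E') (by subst hm; simp [eqsSize, termSize]) E' hE' ⟨τ, hu⟩ rfl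
      refine ⟨θ, hθ.of_equiv (fun τ => by simp [Unifies]) ?_ fun z _ hz => hθ.fixes z hz⟩
      rintro z ⟨p, hp, hz⟩
      exact ⟨p, List.mem_cons_of_mem _ hp, hz⟩
    -- An equation between distinct variables is oriented so that the one of higher rank is
    -- eliminated.
    · rcases le_total (rank y) (rank x) with hr | hr
      · exact elim x (.var y) E' hxS (by simpa using e) (by simpa using hyS) hE'
          (fun z hz => by cases hz; exact hr) hxy hu
      · obtain ⟨θ, hθ⟩ := elim y (.var x) E' hyS (by simpa using Ne.symm e) (by simpa using hxS) hE'
          (fun z hz => by cases hz; exact hr) hxy.symm hu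
        exact ⟨θ, hθ.swap⟩
  | (.var x, .func f ts) :: E', hS, hτ, hm =>
    have hx : τ x = (Term.func f ts).subst τ := hτ _ List.mem_cons_self
    exact elim x (.func f ts) E' (hS x ⟨_, List.mem_cons_self, .inl (by simp)⟩)
      (not_mem_varFinset_of_unifier f ts τ x hx)
      (fun z hz => hS z ⟨_, List.mem_cons_self, .inr hz⟩)
      (fun z ⟨p, hp, hz⟩ => hS z ⟨p, List.mem_cons_of_mem _ hp, hz⟩)
      (fun z hz => by cases hz) hx fun p hp => hτ p (List.mem_cons_of_mem _ hp)
  | (.func f ts, .var x) :: E', hS, hτ, hm =>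
    have hx : τ x = (Term.func f ts).subst τ := (hτ _ List.mem_cons_self).symm
    obtain ⟨θ, hθ⟩ := elim x (.func f ts) E' (hS x ⟨_, List.mem_cons_self, .inr (by simp)⟩)
      (not_mem_varFinset_of_unifier f ts τ x hx)
      (fun z hz => hS z ⟨_, List.mem_cons_self, .inl hz⟩)
      (fun z ⟨p, hp, hz⟩ => hS z ⟨p, List.mem_cons_of_mem _ hp, hz⟩)
      (fun z hz => by cases hz) hx fun p hp => hτ p (List.mem_cons_of_mem _ hp)
    exact ⟨θ, hθ.swap⟩
  | (.func (l := k) f ts, .func (l := l) g us) :: E', hS, hτ, hm =>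
    have hfg : (Term.func f ts).subst τ = (Term.func g us).subst τ := hτ _ List.mem_cons_self
    simp only [Term.subst, Term.func.injEq] at hfg
    obtain ⟨rfl, hfg, hts⟩ := hfg
    obtain rfl := eq_of_heq hfg
    have hts := fun i => congrFun (eq_of_heq hts) i
    have hocc : ∀ z, OccursInEqs (List.ofFn (fun i => (ts i, us i)) ++ E') z ↔
        OccursInEqs ((.func f ts, .func f us) :: E') z := by
      intro z
      simp only [OccursInEqs, List.mem_append, List.mem_ofFn, or_and_right, exists_or,
        exists_exists_eq_and, List.exists_mem_cons_iff, Term.varFinset, Finset.mem_biUnion,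
        Finset.mem_univ, true_and]
    have huni : ∀ τ : V → L.Term V, Unifies (List.ofFn (fun i => (ts i, us i)) ++ E') τ ↔
        Unifies ((.func f ts, .func f us) :: E') τ := by
      intro τ
      simp [Unifies, or_imp, forall_and, Term.subst, funext_iff]
    obtain ⟨θ, hθ⟩ := ihm _ (by
        subst hm
        simp [eqsSize, termSize, List.sum_ofFn, List.map_ofFn, Function.comp_def,
          Finset.sum_add_distrib]
        omega) (List.ofFn (fun i => (ts i, us i)) ++ E')
      (fun z hz => hS z ((hocc z).1 hz)) ⟨τ, (huni τ).2 hτ⟩ rfl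
    exact ⟨θ, hθ.of_equiv huni (fun z => (hocc z).1) fun z hz hz' => absurd ((hocc z).2 hz) hz'⟩

end Terms

theorem Atom.subst_eq_iff {V W : Type} {n : ℕ} (p q : L.Relations n) (ss ts : Fin n → L.Term V)
    (τ : V → L.Term W) :
    (Atom.mk n p ss).subst τ = (Atom.mk n q ts).subst τ ↔
      p = q ∧ ∀ i, (ss i).subst τ = (ts i).subst τ := by
  simp [Atom.subst, funext_iff]

/-- Unifiable atoms have a most general unifier that respects the conventions on variables. -/
theorem exists_isMgu (inputs : Set PVar) (A B : Atom L PVar) (τ : PVar → L.Term PVar)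
    (hτ : A.subst τ = B.subst τ) (hAB : ∀ x ∈ B.vars, x ∉ A.vars ∧ x ∉ inputs) :
    ∃ θ, IsMgu inputs A B θ := by
  classical
  obtain ⟨n, p, ss⟩ := A
  obtain ⟨m, q, ts⟩ := B
  obtain rfl : n = m := congrArg Atom.arity hτ
  obtain ⟨rfl, hu⟩ := (Atom.subst_eq_iff p q ss ts τ).1 hτ
  have huni : ∀ τ : PVar → L.Term PVar, Unifies (List.ofFn fun i => (ss i, ts i)) τ ↔
      ∀ i, (ss i).subst τ = (ts i).subst τ := by
    intro τ
    simp [Unifies]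
  have hocc : ∀ x, OccursInEqs (List.ofFn fun i => (ss i, ts i)) x ↔
      x ∈ (Atom.mk n p ss).vars ∪ (Atom.mk n p ts).vars := by
    intro x
    simp [OccursInEqs, Atom.vars, exists_or]
  obtain ⟨θ, hθ⟩ := exists_isEqMgu
    -- The ranks encode both conventions: input variables are lowest, then the other variables of
    -- `A`, then everything else. Bindings to variables never raise the rank.
    (fun x => if x ∈ inputs then 0 else if x ∈ (Atom.mk n p ss).vars then 1 else 2)
    (Finset.univ.biUnion fun i => (ss i).varFinset ∪ (ts i).varFinset)
    (List.ofFn fun i => (ss i, ts i)) (by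
      intro x hx
      rw [hocc] at hx
      simpa [Atom.vars, exists_or] using hx) ⟨τ, (huni τ).2 hu⟩
  refine ⟨θ, ?_, ?_, ?_, ?_, ?_, ?_⟩
  · exact (Atom.subst_eq_iff _ _ _ _ _).2 ⟨rfl, (huni θ).1 hθ.unifies⟩
  · exact fun τ hτ => hθ.mostGeneral τ ((huni τ).2 ((Atom.subst_eq_iff _ _ _ _ _).1 hτ).2)
  · exact fun x hx => hθ.fixes x fun h => hx ((hocc x).1 h)
  · exact fun x hx y hy => (hocc y).1 (hθ.relevant x ((hocc x).2 hx) y hy)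
  · intro x hx y hy
    have h1 := hθ.rank_le x y hy
    have h2 := (hocc y).1 (hθ.relevant x ((hocc x).2 (.inl hx)) y (by simp [hy]))
    rcases h2 with h2 | h2
    · exact h2
    -- A variable of `B` has rank 2 by `hAB`, while `x` has rank at most 1.
    · simp [hAB y h2, hx] at h1
      split_ifs at h1 <;> omega
  · intro x hx y hy
    have h1 := hθ.rank_le x y hy
    by_contra hn
    simp [hx, hn] at h1
    split_ifs at h1

-- Finiteness of trees and soundness of the exploration

section Trees

variable {P : Program L}

theorem Node.SelectsPos.not_selectsNeg {N : Node L} {A B : Atom L PVar} (h : N.SelectsPos A) :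
    ¬ N.SelectsNeg B := by
  rintro ⟨anc, rest, hB⟩
  obtain ⟨anc', rest', hA⟩ := h
  simp [hA] at hB

theorem Node.exists_of_child {N M : Node L} {C : Clause L} (h : N.child C = some M) :
    ∃ A anc rest θ, N.goal = (.pos A, anc) :: rest ∧
      mgu N.inputs A (C.head.subst (freshen L N.depth)) = some θ ∧ M = N.resolvent C θ := by
  simp only [Node.child, Option.map_eq_some_iff, Node.mguWith] at h
  obtain ⟨θ, hθ, rfl⟩ := h
  split at hθ
  · next A anc rest hg => exact ⟨A, anc, rest, θ, hg, hθ, rfl⟩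
  · simp at hθ

theorem Node.child_eq_of_goal {N : Node L} {A : Atom L PVar} {anc : Set ℕ}
    {rest : List (Literal L PVar × Set ℕ)} {C : Clause L} {θ : PVar → L.Term PVar}
    (hg : N.goal = (.pos A, anc) :: rest)
    (hθ : mgu N.inputs A (C.head.subst (freshen L N.depth)) = some θ) :
    N.child C = some (N.resolvent C θ) := by
  simp [Node.child, Node.mguWith, hg, hθ]

theorem Node.selectsPos_of_child {N M : Node L} {C : Clause L} (h : N.child C = some M) :
    ∃ A, N.SelectsPos A := by
  obtain ⟨A, anc, rest, θ, hg, -⟩ := Node.exists_of_child h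
  exact ⟨A, anc, rest, hg⟩

theorem Node.goal_ne_nil_of_child {N M : Node L} {C : Clause L} (h : N.child C = some M) :
    N.goal ≠ [] := by
  obtain ⟨A, anc, rest, θ, hg, -⟩ := Node.exists_of_child h
  simp [hg]

theorem Node.subsidiary_of_child {N M : Node L} {C : Clause L} (h : N.child C = some M) :
    M.subsidiary = N.subsidiary := by
  obtain ⟨A, anc, rest, θ, hg, -, rfl⟩ := Node.exists_of_child h
  rfl

theorem Node.SelectsPos.goal_ne_nil {N : Node L} {A : Atom L PVar} (h : N.SelectsPos A) :
    N.goal ≠ [] := by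
  obtain ⟨anc, rest, hg⟩ := h
  simp [hg]

theorem Node.SelectsNeg.goal_ne_nil {N : Node L} {A : Atom L PVar} (h : N.SelectsNeg A) :
    N.goal ≠ [] := by
  obtain ⟨anc, rest, hg⟩ := h
  simp [hg]

/-- A tree with a success leaf is not finitely failed. -/
theorem Succeeds.not_finitelyFails {N : Node L} (h : Succeeds P N) : ¬ FinitelyFails P N := by
  -- Negation swaps success and failure between a node and its subsidiary root, so both
  -- incompatibilities are proved in one mutual induction.
  refine Succeeds.rec (motive_1 := fun N _ => ¬ FinitelyFails P N)
    (motive_2 := fun N _ => ¬ Succeeds P N) ?_ ?_ ?_ ?_ ?_ ?_ h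
  · rintro N h (⟨_, A, hA, -⟩ | ⟨_, A, hA, -⟩ | ⟨_, A, hA, -⟩) <;> exact hA.goal_ne_nil h
  · intro N M C hC hM _ ih
    obtain ⟨B, hB⟩ := Node.selectsPos_of_child hM
    rintro (⟨_, A, hA, h⟩ | ⟨_, A, hA, -⟩ | ⟨_, A, hA, -⟩)
    · exact ih (h C hC M hM)
    · exact hB.not_selectsNeg hA
    · exact hB.not_selectsNeg hA
  · intro N A hA hg _ _ ihf ih
    rintro (⟨_, B, hB, -⟩ | ⟨_, B, hB, -, h⟩ | ⟨_, B, hB, -, -, h⟩)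
    · exact hB.not_selectsNeg hA
    · exact ihf h
    · exact ih h
  · rintro N A hA _ ih (⟨_, h⟩ | ⟨_, M, C, hC, hM, h⟩ | ⟨_, B, hB, -⟩)
    · exact hA.goal_ne_nil h
    · exact ih C hC M hM h
    · exact hA.not_selectsNeg hB
  · rintro N A hA hg _ ih (⟨_, h⟩ | ⟨_, M, C, hC, hM, h⟩ | ⟨_, B, hB, -, hf, -⟩)
    · exact hA.goal_ne_nil h
    · obtain ⟨B, hB⟩ := Node.selectsPos_of_child hM
      exact hB.not_selectsNeg hA
    · exact ih hf
  · rintro N A hA hg _ _ _ ih (⟨_, h⟩ | ⟨_, M, C, hC, hM, h⟩ | ⟨_, B, hB, -, -, h⟩)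
    · exact hA.goal_ne_nil h
    · obtain ⟨B, hB⟩ := Node.selectsPos_of_child hM
      exact hB.not_selectsNeg hA
    · exact ih h

theorem Edge.clause_or_negArc_or_naf {N M : Node L} {e : Label L} (h : Edge P N e M) :
    (∃ C bef aft, e = .clause C ∧ P = bef ++ C :: aft ∧ N.child C = some M ∧
      (N.subsidiary = true → ∀ C' ∈ bef, ∀ M', N.child C' = some M' → ¬ Succeeds P M')) ∨
    (∃ A, N.SelectsNeg A ∧ A.Ground ∧ e = .negArc ∧ M = N.negRoot) ∨
    ∃ A, N.SelectsNeg A ∧ A.Ground ∧ e = .naf ∧ FinitelyFails P N.negRoot ∧ M = N.negNext := by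
  cases h with
  | clause _ C bef aft hP hM hpr => exact .inl ⟨C, bef, aft, rfl, hP, hM, hpr⟩
  | negArc A hA hg => exact .inr (.inl ⟨A, hA, hg, rfl, rfl⟩)
  | naf A hA hg hf => exact .inr (.inr ⟨A, hA, hg, rfl, hf, rfl⟩)

theorem Path.cons {N M K : Node L} {e : Label L} {D : List (Node L × Label L)}
    (he : Edge P N e M) (h : Path P M D K) : Path P N ((N, e) :: D) K := by
  induction h with
  | nil => exact Path.snoc [] N M e .nil he
  | snoc D K K' e' _ he' ih => exact Path.snoc _ _ _ _ ih he'

/-- Paths grow at their end, but finiteness of a tree is deduced from its children, which requires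
splitting off the first edge. -/
theorem Path.eq_nil_or_cons {N K : Node L} {D : List (Node L × Label L)} (h : Path P N D K) :
    (D = [] ∧ K = N) ∨ ∃ e M D', Edge P N e M ∧ Path P M D' K ∧ D = (N, e) :: D' := by
  induction h with
  | nil => exact .inl ⟨rfl, rfl⟩
  | snoc D K K' e hD he ih =>
    rcases ih with ⟨rfl, rfl⟩ | ⟨e', M, D', he', hD', rfl⟩
    · exact .inr ⟨e, K', [], he, .nil, rfl⟩
    · exact .inr ⟨e', M, D' ++ [(K, e)], he', .snoc _ _ _ _ hD' he, rfl⟩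

theorem NonFloundering.of_edge {N M : Node L} {e : Label L} (h : NonFloundering P N)
    (he : Edge P N e M) : NonFloundering P M :=
  fun x hx => h ((N, e) :: x.1, x.2) (Path.cons he hx)

/-- The number of children of a node is finite. -/
theorem finite_edges (P : Program L) (N : Node L) : {x : Label L × Node L | Edge P N x.1 x.2}.Finite := by
  have h : ({x : Label L × Node L | ∃ C ∈ P, x.1 = .clause C ∧ N.child C = some x.2}).Finite := by
    refine ((List.finite_toSet P).biUnion (t := fun C => {x : Label L × Node L |
      x.1 = .clause C ∧ N.child C = some x.2}) fun C _ => ?_).subset ?_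
    · refine Set.Subsingleton.finite ?_
      rintro ⟨e, M⟩ ⟨h1, h2⟩ ⟨e', M'⟩ ⟨h1', h2'⟩
      simp_all
    · rintro x ⟨C, hC, hx⟩
      exact Set.mem_biUnion (x := C) hC hx
  refine (h.union (Set.toFinite {(.negArc, N.negRoot), (.naf, N.negNext)})).subset ?_
  rintro ⟨e, M⟩ he
  rcases Edge.clause_or_negArc_or_naf he with
    ⟨C, bef, aft, he, hP, hM, -⟩ | ⟨_, _, _, he, hM⟩ | ⟨_, _, _, he, -, hM⟩
  · exact .inl ⟨C, by simp [hP], he, hM⟩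
  · exact .inr (.inl (Prod.ext he hM))
  · exact .inr (.inr (Prod.ext he hM))

/-- A tree is finite if the trees rooted at its children are. -/
theorem finite_gTree {N : Node L} (h : ∀ e M, Edge P N e M → (GTree P M).Finite) :
    (GTree P N).Finite := by
  refine ((Set.finite_singleton (([], N) : List (Node L × Label L) × Node L)).union
    ((finite_edges P N).biUnion (t := fun x =>
      (fun y : List (Node L × Label L) × Node L => ((N, x.1) :: y.1, y.2)) '' GTree P x.2)
      fun x hx => (h x.1 x.2 hx).image _)).subset ?_
  rintro ⟨D, K⟩ hD
  rcases Path.eq_nil_or_cons hD with ⟨rfl, rfl⟩ | ⟨e, M, D', he, hD', h⟩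
  · exact .inl rfl
  · exact .inr (Set.mem_biUnion (x := (e, M)) he ⟨(D', K), hD', by simpa using h.symm⟩)

/-- A finite tree contains no infinite derivation. -/
theorem InfDerivation.gTree_infinite {R : Node L} (D : InfDerivation P R) :
    (GTree P R).Infinite := by
  have hpath : ∀ n, Path P R ((List.range n).map fun i => (D.node i, D.label i)) (D.node n) := by
    intro n
    induction n with
    | zero => rw [D.root]; exact .nil
    | succ n ih =>
      rw [List.range_succ, List.map_append]
      exact .snoc _ _ _ _ ih (D.edge n)
  refine Set.infinite_of_injective_forall_mem (f := fun n =>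
    ((List.range n).map fun i => (D.node i, D.label i), D.node n)) ?_ fun n => hpath n
  intro m n h
  -- Prefixes of different lengths are different nodes of the tree.
  simpa using congrArg (fun x => x.1.length) h

/-- If the part of the tree below `N` has been constructed without ever setting the flag, then the
tree rooted at `N` is finite, and, in a subsidiary tree, the reported success is correct. -/
theorem Explore.sound {r : ℕ} {D : List (Node L × Label L)} {N : Node L} {b : Bool}
    {o : Outcome} (h : Explore P r D N b o) : ∀ s, .done s false = o →
    b = false ∧ (NonFloundering P N → (GTree P N).Finite ∧
      (N.subsidiary = true → (s = true → Succeeds P N) ∧ (s = false → FinitelyFails P N))) := by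
  -- For a partially processed clause list, `bef` holds the clauses already tried; in a subsidiary
  -- tree all their children have failed. Finiteness is claimed only for children via the remaining
  -- clauses `Cs` that are not pruned by a successful sibling.
  induction h using Explore.rec (motive_2 := fun D N Cs b o _ => ∀ s, .done s false = o →
    b = false ∧ ∀ bef, P = bef ++ Cs → NonFloundering P N →
      (N.subsidiary = true → ∀ C ∈ bef, ∀ M, N.child C = some M → FinitelyFails P M) →
      (∀ C mid aft M, Cs = mid ++ C :: aft → N.child C = some M →
        (N.subsidiary = true → ∀ C' ∈ mid, ∀ M', N.child C' = some M' → ¬ Succeeds P M') →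
        (GTree P M).Finite) ∧
      (N.subsidiary = true →
        (s = true → ∃ C ∈ P, ∃ M, N.child C = some M ∧ Succeeds P M) ∧
        (s = false → ∀ C ∈ P, ∀ M, N.child C = some M → FinitelyFails P M))) with
  | success D N b hN =>
    intro s ho
    cases ho
    refine ⟨rfl, fun _ => ⟨finite_gTree ?_, fun _ => ⟨fun _ => .leaf N hN, nofun⟩⟩⟩
    intro e M he
    rcases he.clause_or_negArc_or_naf with
      ⟨C, bef, aft, -, hP, hM, hpr⟩ | ⟨B, hB, -, -, rfl⟩ | ⟨B, hB, -, -, hf, rfl⟩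
    · exact absurd hN (Node.goal_ne_nil_of_child hM)
    · exact absurd hN hB.goal_ne_nil
    · exact absurd hN hB.goal_ne_nil
  | flounder D N b A hA hg =>
    intro s ho
    cases ho
    exact ⟨rfl, fun h => absurd (h ([], N) .nil A hA) hg⟩
  | positive D N b o A hA _ ih =>
    intro s ho
    obtain ⟨hb, ih⟩ := ih s ho
    refine ⟨hb, fun hnf => ?_⟩
    obtain ⟨hfin, hsub⟩ := ih [] rfl hnf (by simp)
    refine ⟨finite_gTree ?_, fun h => ⟨fun hs => ?_, fun hs => ?_⟩⟩
    · intro e M he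
      rcases he.clause_or_negArc_or_naf with
        ⟨C, bef, aft, -, hP, hM, hpr⟩ | ⟨B, hB, -, -, rfl⟩ | ⟨B, hB, -, -, hf, rfl⟩
      · exact hfin C bef aft M hP hM hpr
      · exact absurd hB hA.not_selectsNeg
      · exact absurd hB hA.not_selectsNeg
    · obtain ⟨C, hC, M, hM, hS⟩ := (hsub h).1 hs
      exact .clause N M C hC hM hS
    · exact .clauses N A hA ((hsub h).2 hs)
  | negAbort => intro s ho; cases ho
  | negSucceeds D N b b' A hA hg _ ih =>
    intro s ho
    cases ho
    obtain ⟨hb, ih⟩ := ih _ rfl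
    refine ⟨hb, fun hnf => ?_⟩
    obtain ⟨hfin, hsub⟩ := ih (hnf.of_edge (.negArc N A hA hg))
    have hS := (hsub rfl).1 rfl
    refine ⟨finite_gTree ?_, fun _ => ⟨nofun, fun _ => .negSucceeds N A hA hg hS⟩⟩
    intro e M he
    rcases he.clause_or_negArc_or_naf with
      ⟨C, bef, aft, -, hP, hM, hpr⟩ | ⟨B, hB, -, -, rfl⟩ | ⟨B, hB, -, -, hf, rfl⟩
    · obtain ⟨B, hB⟩ := Node.selectsPos_of_child hM
      exact absurd hA hB.not_selectsNeg
    · exact hfin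
    -- The subsidiary tree succeeds, so there is no edge removing the negative subgoal.
    · exact absurd hf hS.not_finitelyFails
  | negFails D N b b' o A hA hg _ _ ihf ih =>
    intro s ho
    obtain ⟨rfl, ih1⟩ := ih s ho
    obtain ⟨hb, ihf⟩ := ihf _ rfl
    refine ⟨hb, fun hnf => ?_⟩
    obtain ⟨hfin, hsub⟩ := ihf (hnf.of_edge (.negArc N A hA hg))
    have hF := (hsub rfl).2 rfl
    obtain ⟨hfin', hsub'⟩ := ih1 (hnf.of_edge (.naf N A hA hg hF))
    refine ⟨finite_gTree ?_, fun h => ⟨fun hs => .naf N A hA hg hF ((hsub' h).1 hs),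
      fun hs => .naf N A hA hg hF ((hsub' h).2 hs)⟩⟩
    intro e M he
    rcases he.clause_or_negArc_or_naf with
      ⟨C, bef, aft, -, hP, hM, hpr⟩ | ⟨B, hB, -, -, rfl⟩ | ⟨B, hB, -, -, hf, rfl⟩
    · obtain ⟨B, hB⟩ := Node.selectsPos_of_child hM
      exact absurd hA hB.not_selectsNeg
    · exact hfin
    · exact hfin'
  | nil D N b =>
    rename_i s ho
    cases ho
    refine ⟨rfl, fun bef hP _ hbef => ⟨fun C mid aft M h => by simp at h, fun h => ⟨nofun, ?_⟩⟩⟩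
    intro _ C hC M hM
    exact hbef h C (by simpa [hP] using hC) M hM
  | notApplicable D N C Cs b o hC _ ih =>
    rename_i s ho
    obtain ⟨hb, ih⟩ := ih s ho
    refine ⟨hb, fun bef hP hnf hbef => ?_⟩
    obtain ⟨hfin, hsub⟩ := ih (bef ++ [C]) (by simp [hP]) hnf (by
      intro h C' hC' M hM
      rcases List.mem_append.1 hC' with hC' | hC'
      · exact hbef h C' hC' M hM
      · simp at hC'
        simp [hC', hC] at hM)
    refine ⟨?_, hsub⟩
    rintro C' (_ | ⟨C'', mid⟩) aft M hCs hM hpr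
    · simp at hCs
      simp [← hCs.1, hC] at hM
    · simp at hCs
      exact hfin C' mid aft M hCs.2 hM fun h K hK => hpr h K (List.mem_cons_of_mem _ hK)
  | loopAbort => rename_i s ho; cases ho
  | loopSkip D N M C Cs b o hC hl hd _ ih =>
    rename_i s ho
    -- A skip continues with the flag `true`, but a run ending with `false` must start with `false`.
    exact absurd (ih s ho).1 (by simp)
  | childAbort => rename_i s ho; cases ho
  | firstSuccess D N M C Cs b b' hC hl hs _ ih =>
    rename_i s ho
    cases ho
    obtain ⟨hb, ih⟩ := ih _ rfl
    refine ⟨hb, fun bef hP hnf hbef => ?_⟩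
    -- The child is not pruned, since all earlier siblings failed. The edge is needed to pass
    -- non-floundering on to `M`.
    have he : Edge P N (.clause C) M := .clause N M C bef Cs hP hC fun h C' hC' M' hM' hS =>
      hS.not_finitelyFails (hbef h C' hC' M' hM')
    obtain ⟨hfin, hsub⟩ := ih (hnf.of_edge he)
    have hS := (hsub ((Node.subsidiary_of_child hC).trans hs)).1 rfl
    refine ⟨?_, fun _ => ⟨fun _ => ⟨C, by simp [hP], M, hC, hS⟩, nofun⟩⟩
    rintro C' (_ | ⟨C'', mid⟩) aft M' hCs hM hpr
    · simp at hCs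
      rw [← hCs.1, hC] at hM
      cases hM
      exact hfin
    · simp at hCs
      -- Every later sibling is pruned, as the child via the present clause succeeds.
      exact absurd hS (hpr hs C'' List.mem_cons_self M (hCs.1 ▸ hC))
  | _ =>
    rename_i D N M C Cs b s' b' o hC hl hs _ _ ih ih' s ho
    obtain ⟨rfl, ih1⟩ := ih' s ho
    obtain ⟨hb, ih⟩ := ih _ rfl
    refine ⟨hb, fun bef hP hnf hbef => ?_⟩
    have he : Edge P N (.clause C) M := .clause N M C bef Cs hP hC fun h C' hC' M' hM' hS =>
      hS.not_finitelyFails (hbef h C' hC' M' hM')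
    obtain ⟨hfin, hsub⟩ := ih (hnf.of_edge he)
    obtain ⟨hfin', hsub'⟩ := ih1 (bef ++ [C]) (by simp [hP]) hnf (by
      intro h C' hC' M' hM'
      rcases List.mem_append.1 hC' with hC' | hC'
      · exact hbef h C' hC' M' hM'
      · simp at hC'
        rw [hC', hC] at hM'
        cases hM'
        exact (hsub ((Node.subsidiary_of_child hC).trans h)).2 (by simpa [h] using hs))
    refine ⟨?_, hsub'⟩
    rintro C' (_ | ⟨C'', mid⟩) aft M' hCs hM hpr
    · simp at hCs
      rw [← hCs.1, hC] at hM
      cases hM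
      exact hfin
    · simp at hCs
      exact hfin' C' mid aft M' hCs.2 hM fun h K hK => hpr h K (List.mem_cons_of_mem _ hK)

end Trees

-- Lifting derivations from instances to the moded tree

section Lifting

variable {P : Program L}

theorem Atom.subst_subst {V W X : Type} (A : Atom L V) (σ : V → L.Term W) (τ : W → L.Term X) :
    (A.subst σ).subst τ = A.subst fun x => (σ x).subst τ := by
  simp [Atom.subst, LogicProg.subst_subst]

theorem Atom.subst_congr (A : Atom L PVar) (σ τ : PVar → L.Term PVar)
    (h : ∀ x ∈ A.vars, σ x = τ x) : A.subst σ = A.subst τ := by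
  simp only [Atom.subst, Atom.mk.injEq, heq_eq_eq, true_and]
  exact funext fun i => LogicProg.subst_congr _ _ _ fun x hx => h x ⟨i, hx⟩

theorem Atom.subst_of_ground {A : Atom L PVar} (h : A.Ground) (σ : PVar → L.Term PVar) :
    A.subst σ = A := by
  rw [Atom.subst_congr A σ (fun x => .var x) fun x hx => absurd (h ▸ hx : x ∈ (∅ : Set PVar)) (Set.notMem_empty x)]
  simp [Atom.subst, subst_var]

theorem Atom.mem_vars_subst {V : Type} [DecidableEq V] (A : Atom L V) (σ : V → L.Term PVar)
    (y : PVar) : y ∈ (A.subst σ).vars ↔ ∃ i, ∃ x ∈ (A.args i).varFinset, y ∈ (σ x).varFinset :=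
  exists_congr fun i => mem_varFinset_subst (A.args i) σ y

theorem Atom.exists_of_mem_vars_freshen {A : Atom L ℕ} {d : ℕ} {y : PVar}
    (h : y ∈ (A.subst (freshen L d)).vars) : ∃ x, y = .clause d x := by
  obtain ⟨i, x, -, hy⟩ := (Atom.mem_vars_subst _ _ _).1 h
  exact ⟨x, by simpa [freshen] using hy⟩

theorem Literal.subst_subst {V W X : Type} (l : Literal L V) (σ : V → L.Term W)
    (τ : W → L.Term X) : (l.subst σ).subst τ = l.subst fun x => (σ x).subst τ := by
  cases l <;> simp [Literal.subst, Atom.subst_subst]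

theorem Literal.atom_subst {V W : Type} (l : Literal L V) (σ : V → L.Term W) :
    (l.subst σ).atom = l.atom.subst σ := by
  cases l <;> rfl

theorem Literal.subst_congr (l : Literal L PVar) (σ τ : PVar → L.Term PVar)
    (h : ∀ x ∈ l.atom.vars, σ x = τ x) : l.subst σ = l.subst τ := by
  cases l <;> exact congrArg _ (Atom.subst_congr _ σ τ h)

theorem isMgu_of_mgu {inputs : Set PVar} {A B : Atom L PVar} {θ : PVar → L.Term PVar}
    (h : mgu inputs A B = some θ) : IsMgu inputs A B θ := by
  rw [mgu] at h
  split at h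
  · next h' => exact Option.some.inj h ▸ h'.choose_spec
  · simp at h

/-- The variable `y` is not used in clause copies made at depth `d` or deeper. -/
def PVar.Below (d : ℕ) (y : PVar) : Prop := ∀ k x, y = .clause k x → k < d

theorem PVar.Below.mono {d e : ℕ} (h : d ≤ e) {y : PVar} (hy : y.Below d) : y.Below e :=
  fun k x hk => (hy k x hk).trans_le h

/-- The variables at the node do not occur in clauses renamed at its depth or deeper. -/
structure Node.Apart (N : Node L) : Prop where
  goal : ∀ s ∈ N.goal, ∀ y ∈ s.1.atom.vars, y.Below N.depth
  inputs : ∀ y ∈ N.inputs, y.Below N.depth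

/-- By relevance, the mgu introduces only variables of the selected atom, which are below the
current depth, and of the clause copy made at this depth. -/
theorem Node.Apart.resolvent {N : Node L} (hN : N.Apart) {A : Atom L PVar} {anc : Set ℕ}
    {rest : List (Literal L PVar × Set ℕ)} (hg : N.goal = (.pos A, anc) :: rest) {C : Clause L}
    {θ : PVar → L.Term PVar} (hθ : IsMgu N.inputs A (C.head.subst (freshen L N.depth)) θ) :
    (N.resolvent C θ).Apart := by
  have hA : ∀ y ∈ A.vars, y.Below N.depth := fun y hy => hN.goal (.pos A, anc) (by simp [hg]) y hy
  have hfresh : ∀ x, PVar.Below (N.depth + 1) (.clause N.depth x) := by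
    intro x k x' h
    cases h
    exact Nat.lt_succ_self _
  have hθ' : ∀ x, x.Below (N.depth + 1) → ∀ y ∈ (θ x).varFinset, y.Below (N.depth + 1) := by
    intro x hx y hy
    by_cases h : x ∈ A.vars ∪ (C.head.subst (freshen L N.depth)).vars
    · rcases hθ.relevant x h y hy with h | h
      · exact (hA y h).mono (Nat.le_succ _)
      · obtain ⟨z, rfl⟩ := Atom.exists_of_mem_vars_freshen h
        exact hfresh z
    · rw [hθ.fixes x h] at hy
      simp at hy
      exact hy ▸ hx
  have hlit : ∀ l : Literal L PVar, (∀ x ∈ l.atom.vars, x.Below (N.depth + 1)) →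
      ∀ y ∈ (l.subst θ).atom.vars, y.Below (N.depth + 1) := by
    intro l hl y hy
    rw [Literal.atom_subst] at hy
    obtain ⟨i, x, hx, hy⟩ := (Atom.mem_vars_subst _ _ _).1 hy
    exact hθ' x (hl x ⟨i, hx⟩) y hy
  constructor
  · intro s hs y hy
    simp only [Node.resolvent, hg, List.mem_append, List.mem_map] at hs
    rcases hs with ⟨l, -, rfl⟩ | ⟨s, hs, rfl⟩
    · refine hlit _ (fun x hx => ?_) y hy
      rw [Literal.atom_subst] at hx
      obtain ⟨z, rfl⟩ := Atom.exists_of_mem_vars_freshen hx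
      exact hfresh z
    · exact hlit _ (fun x hx => (hN.goal s (by simp [hg, hs]) x hx).mono (Nat.le_succ _)) y hy
  · rintro y (hy | ⟨x, hx, hy⟩)
    · exact (hN.inputs y hy).mono (Nat.le_succ _)
    · exact hθ' x ((hN.inputs x hx).mono (Nat.le_succ _)) y hy

theorem Node.Apart.negNext {N : Node L} (hN : N.Apart) : N.negNext.Apart where
  goal s hs y hy := (hN.goal s (List.mem_of_mem_tail hs) y hy).mono (Nat.le_succ _)
  inputs y hy := (hN.inputs y hy).mono (Nat.le_succ _)

/-- The node `N'` is an instance of the node `N` under the substitution `σ`; neither lies in a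
subsidiary tree. -/
structure Node.IsInstance (N N' : Node L) (σ : PVar → L.Term PVar) : Prop where
  depth : N'.depth = N.depth
  subsidiary : N.subsidiary = false
  goal : N'.goal = N.goal.map fun s => (s.1.subst σ, s.2)

/-- The lifting lemma for the application of a clause. -/
theorem Node.IsInstance.exists_child {N N' M' : Node L} {σ : PVar → L.Term PVar}
    (h : N.IsInstance N' σ) (hN : N.Apart) {C : Clause L} (hM' : N'.child C = some M') :
    ∃ M, N.child C = some M ∧ M.Apart ∧ ∃ τ, M.IsInstance M' τ := by
  obtain ⟨A', anc, rest', θ', hg', hθ', rfl⟩ := Node.exists_of_child hM'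
  have hmap := h.goal
  rw [hg', eq_comm, List.map_eq_cons_iff] at hmap
  obtain ⟨⟨l, anc'⟩, rest, hg, hl, hrest⟩ := hmap
  cases l with
  | neg A => simp [Literal.subst] at hl
  | pos A =>
  simp only [Literal.subst, Prod.mk.injEq, Literal.pos.injEq] at hl
  obtain ⟨rfl, rfl⟩ := hl
  have hu := (isMgu_of_mgu hθ').unifies
  rw [h.depth] at hu
  classical
  -- A common unifier at the general node: `θ'` on the fresh clause copy, `σ` followed by `θ'`
  -- elsewhere. The cases do not interfere, because `N` is apart from that copy.
  let τ : PVar → L.Term PVar := fun y =>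
    if ∃ x, y = .clause N.depth x then θ' y else (σ y).subst θ'
  have hτ : ∀ y : PVar, y.Below N.depth → τ y = (σ y).subst θ' := by
    intro y hy
    refine if_neg ?_
    rintro ⟨x, rfl⟩
    exact lt_irrefl _ (hy _ _ rfl)
  have hτ' : (fun x => (freshen L N.depth x).subst τ) =
      fun x => (freshen L N.depth x).subst θ' := by
    funext x
    change τ _ = θ' _
    exact if_pos ⟨x, rfl⟩
  have hA : ∀ y ∈ A.vars, y.Below N.depth := fun y hy => hN.goal (.pos A, anc') (by simp [hg]) y hy
  have hunif : A.subst τ = (C.head.subst (freshen L N.depth)).subst τ := by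
    rw [Atom.subst_subst, hτ', ← Atom.subst_subst, ← hu, Atom.subst_subst]
    exact Atom.subst_congr _ _ _ fun y hy => hτ y (hA y hy)
  have hex := exists_isMgu N.inputs A (C.head.subst (freshen L N.depth)) τ hunif (by
    intro y hy
    obtain ⟨x, rfl⟩ := Atom.exists_of_mem_vars_freshen hy
    exact ⟨fun hy => lt_irrefl _ (hA _ hy _ _ rfl), fun hy => lt_irrefl _ (hN.inputs _ hy _ _ rfl)⟩)
  obtain ⟨θ, hθ⟩ : ∃ θ, mgu N.inputs A (C.head.subst (freshen L N.depth)) = some θ :=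
    ⟨_, dif_pos hex⟩
  have hmgu := isMgu_of_mgu hθ
  -- Most generality in its idempotent form: `τ` absorbs `θ`, so `τ` itself exhibits the concrete
  -- child as an instance of the general one.
  have hθτ : (fun x => (θ x).subst τ) = τ := funext (hmgu.mostGeneral τ hunif)
  refine ⟨N.resolvent C θ, Node.child_eq_of_goal hg hθ, hN.resolvent hg hmgu, τ, ?_, h.subsidiary,
    ?_⟩
  · simp [Node.resolvent, h.depth]
  · simp only [Node.resolvent, hg', hg, List.map_append, List.map_map, ← hrest, h.depth]
    congr 1
    · refine List.map_congr_left fun l _ => ?_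
      simp only [Function.comp, Prod.mk.injEq, and_true]
      rw [Literal.subst_subst _ θ τ, hθτ, Literal.subst_subst, Literal.subst_subst, hτ']
    · refine List.map_congr_left fun s hs => ?_
      simp only [Function.comp, Prod.mk.injEq, and_true]
      rw [Literal.subst_subst _ θ τ, hθτ, Literal.subst_subst]
      exact (Literal.subst_congr _ _ _ fun y hy => hτ y (hN.goal s (by simp [hg, hs]) y hy)).symm

/-- Either the nodes coincide, or the second one is an instance of the first. -/
def Node.Lifts (N N' : Node L) : Prop :=
  N = N' ∨ N.Apart ∧ ∃ σ, N.IsInstance N' σ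

/-- The lifting lemma for generalized SLDNF-trees. -/
theorem Node.Lifts.exists_edge {N N' M' : Node L} {e : Label L} (h : N.Lifts N')
    (hnf : NonFloundering P N) (he : Edge P N' e M') : ∃ M, Edge P N e M ∧ M.Lifts M' := by
  rcases h with rfl | ⟨hN, σ, h⟩
  · exact ⟨M', he, .inl rfl⟩
  -- By non-floundering the negated atom at `N` is already ground, so `σ` leaves it unchanged and
  -- the two subsidiary roots are equal.
  have hneg : ∀ A', N'.SelectsNeg A' → N.SelectsNeg A' ∧ A'.Ground ∧ N'.negRoot = N.negRoot := by
    rintro A' ⟨anc, rest', hg'⟩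
    have hmap := h.goal
    rw [hg', eq_comm, List.map_eq_cons_iff] at hmap
    obtain ⟨⟨l, anc'⟩, rest, hg, hl, hrest⟩ := hmap
    cases l with
    | pos A => simp [Literal.subst] at hl
    | neg A =>
    simp only [Literal.subst, Prod.mk.injEq, Literal.neg.injEq] at hl
    obtain ⟨rfl, rfl⟩ := hl
    have hA : A.Ground := hnf ([], N) .nil A ⟨anc', rest, hg⟩
    rw [Atom.subst_of_ground hA] at hg' ⊢
    exact ⟨⟨anc', rest, hg⟩, hA, by simp [Node.negRoot, h.depth, hg, hg']⟩
  rcases he.clause_or_negArc_or_naf with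
    ⟨C, bef, aft, rfl, hP, hM, -⟩ | ⟨A, hA, -, rfl, rfl⟩ | ⟨A, hA, -, rfl, hf, rfl⟩
  · obtain ⟨M, hM, hap, τ, hτ⟩ := h.exists_child hN hM
    -- Success of a sibling need not agree between a node and its instance, but pruning only
    -- concerns subsidiary trees, where the nodes coincide.
    exact ⟨M, .clause N M C bef aft hP hM (by simp [h.subsidiary]), .inr ⟨hap, τ, hτ⟩⟩
  · obtain ⟨hA, hg, heq⟩ := hneg A hA
    exact ⟨N.negRoot, .negArc N A hA hg, .inl heq.symm⟩
  · obtain ⟨hA, hg, heq⟩ := hneg A hA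
    exact ⟨N.negNext, .naf N A hA hg (heq ▸ hf), .inr ⟨hN.negNext, σ, by simp [Node.negNext, h.depth],
      h.subsidiary, by simp [Node.negNext, h.goal]⟩⟩

/-- Infinite derivations can be lifted. -/
theorem InfDerivation.nonempty_of_lifts {R R' : Node L} (D : InfDerivation P R') (h : R.Lifts R')
    (hnf : NonFloundering P R) : Nonempty (InfDerivation P R) := by
  have step : ∀ (i : ℕ) (N : {N : Node L // N.Lifts (D.node i) ∧ NonFloundering P N}),
      ∃ M : {M : Node L // M.Lifts (D.node (i + 1)) ∧ NonFloundering P M},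
        Edge P N.1 (D.label i) M.1 := by
    rintro i ⟨N, hN, hnf⟩
    obtain ⟨M, he, hM⟩ := hN.exists_edge hnf (D.edge i)
    exact ⟨⟨M, hM, hnf.of_edge he⟩, he⟩
  choose next hnext using step
  let seq : ∀ i, {N : Node L // N.Lifts (D.node i) ∧ NonFloundering P N} :=
    fun i => Nat.rec ⟨R, by rwa [D.root], hnf⟩ next i
  exact ⟨⟨fun i => (seq i).1, D.label, rfl, fun i => hnext i (seq i)⟩⟩

/-- The root of the moded tree is more general than the roots in the moded-query forest. -/
theorem Query.modedRoot_lifts {c : L.Constants} {Q : Query L} {R : Node L}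
    (hR : R ∈ forestRoots P c Q) : Q.modedRoot.Lifts R := by
  obtain ⟨ρ, -, rfl⟩ := hR
  refine .inr ⟨⟨?_, ?_⟩, fun y => match y with
    -- The value for `i` beyond the arity is arbitrary: no such variable occurs at the root.
    -- Likewise, the bindings at arguments that are not input modes have no effect.
    | .input i => if h : i < Q.arity then ρ ⟨i, h⟩ else .var (.input i)
    | y => .var y, rfl, rfl, ?_⟩
  · intro s hs y hy k x hk
    simp only [Query.modedRoot, rootNode, List.mem_singleton] at hs
    subst hs hk
    obtain ⟨i, hy⟩ := hy
    simp only [Query.fill, Literal.atom] at hy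
    split at hy
    · simp at hy
    · obtain ⟨z, -, hz⟩ := (mem_varFinset_subst _ _ _).1 hy
      simp at hz
  · rintro y ⟨i, -, rfl⟩ k x hk
    cases hk
  · simp only [Query.modedRoot, rootNode, List.map_cons, List.map_nil, Literal.subst, Query.fill,
      Atom.subst]
    congr 4
    funext i
    cases Q.args i with
    | none => simp [FirstOrder.Language.Term.subst]
    | some t => simp only [LogicProg.subst_subst]; rfl

end Lifting

end LogicProg

theorem mainTheorem8 {L : FirstOrder.Language} (c : L.Constants)
    (P : LogicProg.Program L) (Q₀ : LogicProg.Query L) (r : ℕ) (hr : 2 ≤ r)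
    (hnf : LogicProg.NonFloundering P Q₀.modedRoot)
    (halg : LogicProg.TPoLPReturns P Q₀ r LogicProg.Answer.terminating) :
    LogicProg.Terminates P c Q₀ ∧
    (LogicProg.ModedTree P Q₀).Finite ∧
    ¬ ∃ D : LogicProg.InfDerivation P Q₀.modedRoot,
        D.LoopSequence ∧
        ∀ I ∈ ⋃ k, (D.node k).inputs, ¬ D.InfChain I := by
  obtain ⟨s, hs⟩ := halg
  have hfin : (LogicProg.GTree P Q₀.modedRoot).Finite := ((hs.sound s rfl).2 hnf).1
  refine ⟨fun R hR => ⟨fun D => ?_⟩, hfin, fun ⟨D, _⟩ => D.gTree_infinite hfin⟩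
  obtain ⟨D'⟩ := D.nonempty_of_lifts (LogicProg.Query.modedRoot_lifts hR) hnf
  exact D'.gTree_infinite hfin
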